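/- Notation. Write $\tau=u+iv\in\mathbb{H}$ and $e(z)=\exp(2\pi i z)$. For odd $d$ put $\epsilon_d=1$ if $d\equiv 1\pmod 4$ and $\epsilon_d=i$ if $d\equiv 3\pmod 4$. $\left(\frac{\cdot}{\cdot}\right)$ is the Jacobi symbol; for negative odd $d$ put $\left(\frac{c}{d}\right)=-\left(\frac{c}{|d|}\right)$ if $c<0$ and $\left(\frac{c}{d}\right)=\left(\frac{c}{|d|}\right)$ otherwise. The theta multiplier is $\nu_\theta(\gamma)=\left(\frac{c}{d}\right)\epsilon_d^{-1}$ for $\gamma=\begin{pmatrix}a&b\\c&d\end{pmatrix}\in\Gamma_0(4)$, and $(f|_\kappa\gamma)(\tau)=(c\tau+d)^{-\kappa}f(\gamma\tau)$ (principal branch) for $\gamma\in\mathrm{SL}_2(\mathbb{Z})$. For odd $N,k\in\mathbb{Z}_{\ge1}$ let $\mathbb{M}_{k/2}(\Gamma_0(4N))$ be the space of harmonic Maass forms of weight $k/2$: smooth $F:\mathbb{H}\to\mathbb{C}$ with $F|_{k/2}\gamma=\nu_\theta(\gamma)^kF$ for all $\gamma\in\Gamma_0(4N)$, annihilated by $\Delta_{k/2}=-v^2(\partial_u^2+\partial_v^2)+i\frac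 k2v(\partial_u+i\partial_v)$, and such that for every $\gamma\in\mathrm{SL}_2(\mathbb{Z})$ there is $A$ with $(F|_{k/2}\gamma)(\tau)=O(v^A)$ as $v\to\infty$, uniformly in $u$. Such $F$ is $1$-periodic; let $a(n,v)$ be its Fourier coefficients, so that $$F(\tau)=\sum_{n\in\mathbb{Z}}a(n,v)\,e(n\tau)\quad\text{(absolutely convergent)},\qquad (\mathrm{U}_{m,t}F)(\tau):=\sum_{n\equiv t\,(\mathrm{mod}\ m)}a\big(n,\tfrac vm\big)\,e\big(\tfrac{n\tau}{m}\big).$$ Lemma. Let $N,k\ge1$ be odd integers and $F\in\mathbb{M}_{k/2}(\Gamma_0(4N))$ with Fourier coefficients $a(n,v)$. Let $m\in\mathbb{Z}_{\ge1}$, $t\in\{0,\dots,m-1\}$, $C\in\mathbb{Z}_{\ge1}$, and $\gamma=\begin{pmatrix}1&B\\4NC&D\end{pmatrix}\in\Gamma_0(4N)$ such that $C\mid m$ and $\gcd(m/C,4NC)=1$. Let $x,y\in\mathbb{Z}$ satisfy $4NCx+\frac mCy=1$ and $x\equiv0\pmod C$. Then for all $\tau\in\mathbb{H}$, with all series absolutely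 convergent, $$\big(\mathrm{U}_{m,t}F\big|_{\frac k2}\gamma\big)(\tau)=\frac Cm\sum_{d\mid\frac mC}e\Big(\frac{xt}{m}\Big)\,e\Big(\frac{tyB}{C}+\frac{d^2\overline d^2xDt}{m}\Big)\,\epsilon_d^{-k}\,\delta_d\,d^{\frac k2}\sum_{n\in\mathbb{Z}}a\Big(Cn+\overline d^2t,\tfrac{d^2}{m}\mathrm{Im}(\tau)\Big)\,T(n,d)\,e\Big(\frac{d^2(Cn+\overline d^2t)}{m}\tau\Big),$$ where $d$ runs over the positive divisors of $m/C$, $\overline d$ is the smallest non-negative integer with $d\overline d\equiv1\pmod C$, $$T(n,d)=e\Big(\frac{d^2Dnx}{m/C}\Big)\left(\frac{NC}{m/(Cd)}\right)\sum_{\substack{0\le s<\frac m{Cd}\\\gcd(s,\frac m{Cd})=1}}\left(\frac{s}{m/(Cd)}\right)e\Big(\frac{-(x/C)\big(\overline s(\overline d^2t+Cn)+st\big)}{m/(Cd)}\Big)$$ with $\overline s$ an integer such that $\overline ss\equiv1\pmod{\frac m{Cd}}$, and $$\delta_d=(-1)^{\frac{d-1}2\cdot\frac{(Nm/(Cd))-1}2}\left(\frac{NC}{m/(Cd)}\right)\left(\frac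 dN\right).$$ -/

import Mathlib

open scoped UpperHalfPlane Real MatrixGroups ContDiff
open UpperHalfPlane (ofComplex atImInfty)

noncomputable section

namespace ThetaMaass

/-- `e(z) = exp(2πi z)`. -/
def e (z : ℂ) : ℂ := Complex.exp (2 * π * Complex.I * z)

/-- For odd `d`: `ε_d = 1` if `d ≡ 1 (mod 4)` and `ε_d = i` if `d ≡ 3 (mod 4)`. -/
def eps (d : ℤ) : ℂ := if d % 4 = 1 then 1 else Complex.I

/-- The Jacobi symbol `(c/d)` extended to negative odd `d` by the usual convention of the theta
multiplier: `(c/d) = (c/|d|)` unless `c` and `d` are both negative, in which case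
`(c/d) = -(c/|d|)`. In particular `(0/±1) = 1`. -/
def extJacobi (c d : ℤ) : ℤ :=
  if c < 0 ∧ d < 0 then -jacobiSym c d.natAbs else jacobiSym c d.natAbs

/-- The theta multiplier `ν_θ(γ) = (c/d) ε_d⁻¹` for `γ = (a b; c d) ∈ Γ₀(4)`. -/
def thetaMultiplier (γ : SL(2, ℤ)) : ℂ := (extJacobi (γ 1 0) (γ 1 1) : ℂ) * (eps (γ 1 1))⁻¹

/-- The weight-`κ` slash operator `(f |_κ γ)(τ) = (cτ + d)^(-κ) f(γτ)` for `γ = (a b; c d)` of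
determinant one, with the principal branch of the power. -/
def slash (κ : ℝ) (f : ℍ → ℂ) (γ : SL(2, ℤ)) (τ : ℍ) : ℂ :=
  ((γ 1 0 : ℂ) * (τ : ℂ) + (γ 1 1 : ℂ)) ^ (-(κ : ℂ)) * f (γ • τ)

/-- A function on the upper half plane, viewed as a function on `ℂ`
(only its values at points of positive imaginary part matter). -/
def ext (f : ℍ → ℂ) (z : ℂ) : ℂ := f (ofComplex z)

/-- The weight-`κ` hyperbolic Laplace operator
`Δ_κ = -v² (∂²/∂u² + ∂²/∂v²) + i κ v (∂/∂u + i ∂/∂v)`, where `τ = u + i v`. -/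
def hypLaplacian (κ : ℝ) (f : ℍ → ℂ) (τ : ℍ) : ℂ :=
  -(τ.im : ℂ) ^ 2 * Laplacian.laplacian (ext f) (τ : ℂ) +
    Complex.I * (κ : ℂ) * (τ.im : ℂ) *
      (fderiv ℝ (ext f) (τ : ℂ) 1 + Complex.I * fderiv ℝ (ext f) (τ : ℂ) Complex.I)

/-- `F` is a harmonic Maass form of weight `k/2` (for odd `k`) on `Γ₀(M)` (for `4 ∣ M`) with
multiplier `ν_θ^k`, of moderate growth at all cusps. -/
structure IsHarmonicMaassForm (k : ℤ) (M : ℕ) (F : ℍ → ℂ) : Prop where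
  smooth : ContDiffOn ℝ ∞ (ext F) {z : ℂ | 0 < z.im}
  modular : ∀ γ ∈ CongruenceSubgroup.Gamma0 M, ∀ τ : ℍ,
    slash ((k : ℝ) / 2) F γ τ = thetaMultiplier γ ^ k * F τ
  harmonic : ∀ τ : ℍ, hypLaplacian ((k : ℝ) / 2) F τ = 0
  moderate : ∀ γ : SL(2, ℤ), ∃ A : ℝ,
    slash ((k : ℝ) / 2) F γ =O[atImInfty] fun τ : ℍ => τ.im ^ A

/-- The Fourier coefficient `c(F; n; v)` of a one-periodic function, so that
`F(τ) = ∑ₙ c(F; n; Im τ) e(nτ)`. -/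
def coeff (F : ℍ → ℂ) (n : ℤ) (v : ℝ) : ℂ :=
  ∫ u in (0 : ℝ)..1, ext F (u + v * Complex.I) * e (-(n : ℂ) * (u + v * Complex.I))

/-- The summand with index `n` of the series that defines `U_{a,b} F`. -/
def UTerm (a : ℕ) (b : ℤ) (F : ℍ → ℂ) (τ : ℍ) (n : ℤ) : ℂ :=
  if n ≡ b [ZMOD (a : ℤ)] then coeff F n (τ.im / a) * e ((n : ℂ) * (τ : ℂ) / a) else 0

/-- The operator `U_{a,b}`:
`(U_{a,b} F)(τ) = ∑_{n ≡ b (mod a)} c(F; n; Im(τ)/a) e(nτ/a)`. -/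
def U (a : ℕ) (b : ℤ) (F : ℍ → ℂ) (τ : ℍ) : ℂ := ∑' n : ℤ, UTerm a b F τ n

/-- The smallest non-negative inverse of `d` modulo `M` (for `d` coprime to `M ≥ 1`). -/
def invMod (d M : ℕ) : ℕ := sInf {j : ℕ | d * j ≡ 1 [MOD M]}

/-- `δ_d = (-1)^((d-1)/2 · ((Nm/(Cd))-1)/2) (NC / (m/(Cd))) (d/N)`. -/
def delta (N m C d : ℕ) : ℂ :=
  (-1 : ℂ) ^ (((d - 1) / 2) * ((N * (m / (C * d)) - 1) / 2)) *
    (jacobiSym ((N : ℤ) * C) (m / (C * d)) : ℂ) * (jacobiSym (d : ℤ) N : ℂ)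

/-- The sum `T(n, d)`. Here `x` is divisible by `C`, and `C * d` divides `m`. -/
def T (N m t C : ℕ) (D x n : ℤ) (d : ℕ) : ℂ :=
  e (((d : ℂ) ^ 2 * D * n * x) / ((m / C : ℕ) : ℂ)) *
    (jacobiSym ((N : ℤ) * C) (m / (C * d)) : ℂ) *
    ∑ s ∈ (Finset.range (m / (C * d))).filter (fun s => Nat.gcd s (m / (C * d)) = 1),
      (jacobiSym (s : ℤ) (m / (C * d)) : ℂ) *
        e ((-((x / (C : ℤ)) * ((invMod s (m / (C * d)) : ℤ) * ((invMod d C : ℤ) ^ 2 * t + C * n) +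
          (s : ℤ) * t)) : ℤ) / ((m / (C * d) : ℕ) : ℂ))

/-- The summand with index `n` of the inner series belonging to the divisor `d`:
`a(Cn + d̄²t, d² Im(τ)/m) T(n, d) e(d² (Cn + d̄²t) τ / m)`. -/
def innerTerm (F : ℍ → ℂ) (N m t C : ℕ) (D x : ℤ) (τ : ℍ) (d : ℕ) (n : ℤ) : ℂ :=
  coeff F ((C : ℤ) * n + (invMod d C : ℤ) ^ 2 * t) ((d : ℝ) ^ 2 / m * τ.im) *
    T N m t C D x n d *
    e ((d : ℂ) ^ 2 * ((C : ℂ) * n + (invMod d C : ℂ) ^ 2 * t) / m * (τ : ℂ))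

end ThetaMaass

end

namespace ThetaMaass

/-! ### The exponential `e` -/

/-! By orthogonality of additive characters, `U m t F` at `τ` is the average of `e(-jt/m) F((τ +
j)/m)` over `j` mod `m` (`hasSum_UTerm`), so it suffices to move `F` at `(γτ + j)/m` back to a
translate of a multiple of `τ`. Let `d = gcd(1 + 4NCj, m/C)` and `m = Cdq`. Then `(1, j; 0, m)γ = g
(d, β; 0, Cq)` with `g ∈ Γ₀(4N)` (`exists_matrix_factorization`). Modularity under `g` gives `F((d²τ
+ dβ)/m)` times `d^(k/2)` and a theta multiplier, which quadratic reciprocity evaluates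
(`extJacobi_eq`, `transform_translate`). Since `4NCx ≡ 1` mod `m/C`, the classes with a given `d`
are `j = -x + xds + dqr`, with `s` a unit mod `q` and `r` mod `C` (`sum_range_reindex`). After
Fourier expansion, `r` enters through one additive character mod `C`, whose sum keeps the
frequencies with `d²n ≡ t` mod `C`; the sum over `s` is the one in `T` (`sum_translates_eq`).
Absolute convergence holds because Fourier coefficients of periodic `C²` functions are `O(n⁻²)`. -/

lemma e_add (z w : ℂ) : e (z + w) = e z * e w := by
  simp only [e, ← Complex.exp_add]; ring_nf

lemma e_zero : e 0 = 1 := by simp [e]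

lemma e_intCast (n : ℤ) : e n = 1 := by
  rw [e, mul_comm]
  exact Complex.exp_int_mul_two_pi_mul_I n

lemma e_add_intCast (z : ℂ) (n : ℤ) : e (z + n) = e z := by
  rw [e_add, e_intCast, mul_one]

lemma e_eq_of_sub_eq_intCast {z w : ℂ} (n : ℤ) (h : z - w = n) : e z = e w := by
  rw [← e_add_intCast w n, ← h]; ring_nf

lemma norm_e_ofReal (r : ℝ) : ‖e r‖ = 1 := by
  rw [e, show (2 * π * Complex.I * r : ℂ) = ((2 * π * r : ℝ) : ℂ) * Complex.I by push_cast; ring]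
  exact Complex.norm_exp_ofReal_mul_I _

lemma e_natCast_mul (n : ℕ) (z : ℂ) : e (n * z) = e z ^ n := by
  rw [e, e, ← Complex.exp_nat_mul]; ring_nf

/-- Two fractions with congruent numerators have the same exponential. -/
lemma e_div_eq_of_modEq {q : ℕ} (hq : q ≠ 0) {a b : ℤ} (h : a ≡ b [ZMOD q]) :
    e ((a : ℂ) / q) = e ((b : ℂ) / q) := by
  obtain ⟨r, hr⟩ := h.symm.dvd
  refine e_eq_of_sub_eq_intCast r ?_
  have hq' : (q : ℂ) ≠ 0 := by exact_mod_cast hq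
  have : (a : ℂ) - b = q * r := by exact_mod_cast hr
  rw [← sub_div, this]
  field_simp

lemma e_div_eq_one_iff {q : ℕ} (hq : q ≠ 0) (a : ℤ) : e ((a : ℂ) / q) = 1 ↔ (q : ℤ) ∣ a := by
  have hq' : (q : ℂ) ≠ 0 := by exact_mod_cast hq
  constructor
  · intro h
    rw [e, Complex.exp_eq_one_iff] at h
    obtain ⟨n, hn⟩ := h
    refine ⟨n, ?_⟩
    have h2 : (2 * π * Complex.I : ℂ) ≠ 0 := Complex.two_pi_I_ne_zero
    have h3 : (a : ℂ) / q = n := by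
      apply mul_left_cancel₀ h2
      rw [hn]; ring
    rw [div_eq_iff hq'] at h3
    have : (a : ℂ) = (q : ℂ) * n := by rw [h3]; ring
    exact_mod_cast this
  · intro h
    have := e_div_eq_of_modEq hq (Int.modEq_zero_iff_dvd.mpr h)
    simpa [e_zero] using this

/-- Orthogonality of the additive characters modulo `q`. -/
lemma sum_range_e_div {q : ℕ} (hq : q ≠ 0) (a : ℤ) :
    ∑ r ∈ Finset.range q, e ((r : ℂ) * (a / q)) = if (q : ℤ) ∣ a then (q : ℂ) else 0 := by
  have hq' : (q : ℂ) ≠ 0 := by exact_mod_cast hq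
  simp_rw [e_natCast_mul]
  split_ifs with h
  · rw [(e_div_eq_one_iff hq a).mpr h]; simp
  · have h1 : e ((a : ℂ) / q) ≠ 1 := fun h' => h ((e_div_eq_one_iff hq a).mp h')
    rw [geom_sum_eq h1, ← e_natCast_mul, mul_div_cancel₀ _ hq', e_intCast]
    simp

/-! ### Fourier expansion -/

lemma hasDerivAt_e_mul (c : ℂ) (u : ℝ) :
    HasDerivAt (fun u : ℝ => e (c * u)) (2 * π * Complex.I * c * e (c * u)) u := by
  have h1 : HasDerivAt (fun z : ℂ => 2 * π * Complex.I * (c * z)) (2 * π * Complex.I * (c * 1))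
      (u : ℂ) := ((hasDerivAt_id (u : ℂ)).const_mul c).const_mul _
  have h2 := h1.cexp.comp_ofReal
  simp only [e]
  convert h2 using 1
  ring

lemma continuous_e : Continuous e := by
  unfold e; fun_prop

/-- Integration by parts: periodicity of `f` and `e(-n) = 1` cancel the boundary terms. Used twice,
it gives decay of order `n⁻²`. -/
lemma integral_deriv_mul_e {f f' : ℝ → ℂ} (hf : ∀ u, HasDerivAt f (f' u) u)
    (hf' : Continuous f') (h1 : f 1 = f 0) (n : ℤ) :
    ∫ u in (0 : ℝ)..1, f' u * e (-n * u) =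
      2 * π * Complex.I * n * ∫ u in (0 : ℝ)..1, f u * e (-n * u) := by
  have hc : Continuous fun u : ℝ => e (-n * u) := continuous_e.comp (by fun_prop)
  have key := intervalIntegral.integral_mul_deriv_eq_deriv_mul (a := 0) (b := 1)
    (fun u _ => hf u) (fun u _ => hasDerivAt_e_mul (-n) u) (hf'.intervalIntegrable _ _)
    ((continuous_const.mul hc).intervalIntegrable _ _)
  have e1 : e (-n * ((1 : ℝ) : ℂ)) = 1 := by
    rw [← e_intCast (-n)]; push_cast; ring_nf
  have e0 : e (-n * ((0 : ℝ) : ℂ)) = 1 := by simp [e_zero]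
  rw [e1, e0, h1, sub_self, zero_sub] at key
  rw [← neg_inj, ← key, ← intervalIntegral.integral_const_mul,
    ← intervalIntegral.integral_neg]
  congr 1
  ext u
  ring

/-- The Fourier series of a one-periodic `C²` function converges absolutely to the function. -/
lemma hasSum_fourier_of_contDiff {f : ℝ → ℂ} (hf : ContDiff ℝ 2 f) (hper : Function.Periodic f 1)
    (u : ℝ) :
    HasSum (fun n : ℤ => (∫ w in (0 : ℝ)..1, f w * e (-n * w)) * e (n * u)) (f u) := by
  have hd1 : ContDiff ℝ 1 (deriv f) := by
    have : ContDiff ℝ (1 + 1) f := by exact_mod_cast hf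
    exact (contDiff_succ_iff_deriv.mp this).2.2
  have hd2 : Continuous (deriv (deriv f)) := hd1.continuous_deriv le_rfl
  have hD0 : ∀ u, HasDerivAt f (deriv f u) u := fun u =>
    (hf.differentiable (by norm_num) u).hasDerivAt
  have hD1 : ∀ u, HasDerivAt (deriv f) (deriv (deriv f) u) u := fun u =>
    (hd1.differentiable (by norm_num) u).hasDerivAt
  have hper1 : deriv f 1 = deriv f 0 := by
    have h : (fun x => f (x + 1)) = f := funext hper
    have := deriv_comp_add_const f 1 0
    rw [h, zero_add] at this
    exact this.symm
  have hf1 : f 1 = f 0 := by simpa using hper 0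
  obtain ⟨K, hK⟩ := (isCompact_Icc (a := (0 : ℝ)) (b := 1)).exists_bound_of_continuousOn
    hd2.continuousOn
  have hcoeff : ∀ n : ℤ, ‖∫ w in (0 : ℝ)..1, deriv (deriv f) w * e (-n * w)‖ ≤ K := by
    intro n
    have := intervalIntegral.norm_integral_le_of_norm_le_const (a := 0) (b := 1) (C := K)
      (f := fun w : ℝ => deriv (deriv f) w * e (-n * w)) ?_
    · simpa using this
    · intro w hw
      rw [Set.uIoc_of_le zero_le_one] at hw
      have h1 : ‖e (-n * (w : ℂ))‖ = 1 := by
        have := norm_e_ofReal (-n * w)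
        push_cast at this; exact this
      rw [norm_mul, h1, mul_one]
      exact hK w ⟨hw.1.le, hw.2⟩
  have hsum : Summable fun n : ℤ => ∫ w in (0 : ℝ)..1, f w * e (-n * w) := by
    have hs : Summable fun n : ℤ => K * (1 / (n : ℝ) ^ 2) :=
      (Real.summable_one_div_int_pow.mpr one_lt_two).mul_left K
    refine Summable.of_norm_bounded_eventually hs ?_
    -- Only `n = 0` is excepted: there the majorant is `1/0 = 0`.
    refine (Set.finite_singleton (0 : ℤ)).subset fun n hn => ?_
    by_contra hn0
    apply hn
    have hn0' : (n : ℝ) ≠ 0 := by exact_mod_cast hn0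
    have hb := hcoeff n
    rw [integral_deriv_mul_e hD1 hd2 hper1, integral_deriv_mul_e hD0 hd1.continuous hf1] at hb
    simp only [norm_mul, Complex.norm_I, Complex.norm_real, Complex.norm_intCast, Complex.norm_ofNat,
      mul_one, Real.norm_of_nonneg Real.pi_pos.le] at hb
    set J := ‖∫ w in (0 : ℝ)..1, f w * e (-n * w)‖
    have hJ : 0 ≤ J := norm_nonneg _
    have hpi : 1 ≤ 2 * π := by linarith [Real.pi_gt_three]
    have h4 : (n : ℝ) ^ 2 * J ≤ K := by
      have h5 : 2 * π * |(n : ℝ)| * (2 * π * |(n : ℝ)| * J) = (2 * π) ^ 2 * ((n : ℝ) ^ 2 * J) := by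
        rw [← sq_abs (n : ℝ)]; ring
      rw [h5] at hb
      have h6 : 0 ≤ (n : ℝ) ^ 2 * J := by positivity
      nlinarith [one_le_pow₀ hpi (n := 2)]
    show J ≤ K * (1 / (n : ℝ) ^ 2)
    rw [mul_one_div, le_div_iff₀ (by positivity)]
    linarith
  have : Fact ((0 : ℝ) < 1) := ⟨one_pos⟩
  let g : C(AddCircle (1 : ℝ), ℂ) := ⟨hper.lift, continuous_coinduced_dom.mpr hf.continuous⟩
  have hg : ∀ n, fourierCoeff g n = ∫ w in (0 : ℝ)..1, f w * e (-n * w) := by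
    intro n
    rw [fourierCoeff_eq_intervalIntegral g n 0]
    simp only [zero_add, div_one, one_smul]
    congr 1
    ext w
    rw [fourier_coe_apply, smul_eq_mul, mul_comm]
    congr 1
    simp only [e]
    push_cast
    ring_nf
  have hsum' : Summable (fourierCoeff g) := by
    rw [show fourierCoeff g = _ from funext hg]; exact hsum
  have := has_pointwise_sum_fourier_series_of_summable hsum' (u : AddCircle (1 : ℝ))
  convert this using 2 with n
  · rw [hg, smul_eq_mul, fourier_coe_apply]
    congr 1
    simp only [e]
    push_cast
    ring_nf
  · exact (hper.lift_coe u).symm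

lemma ext_coe (F : ℍ → ℂ) (τ : ℍ) : ext F (τ : ℂ) = F τ := by
  rw [ext, UpperHalfPlane.ofComplex_apply]

lemma ext_of_im_pos (F : ℍ → ℂ) {z : ℂ} (hz : 0 < z.im) : ext F z = F ⟨z, hz⟩ := by
  rw [ext, UpperHalfPlane.ofComplex_apply_of_im_pos hz]

/-- The Fourier expansion of a smooth function on the upper half plane with period one. -/
lemma hasSum_coeff {F : ℍ → ℂ} (hF : ContDiffOn ℝ ∞ (ext F) {z : ℂ | 0 < z.im})
    (hper : ∀ z : ℂ, 0 < z.im → ext F (z + 1) = ext F z) {z : ℂ} (hz : 0 < z.im) :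
    HasSum (fun n : ℤ => coeff F n z.im * e (n * z)) (ext F z) := by
  set f : ℝ → ℂ := fun u => ext F (u + z.im * Complex.I) with hfdef
  have him : ∀ u : ℝ, ((u : ℂ) + z.im * Complex.I).im = z.im := fun u => by simp
  have hf : ContDiff ℝ 2 f := by
    rw [← contDiffOn_univ]
    refine (contDiffOn_infty.mp hF 2).comp (t := {z : ℂ | 0 < z.im})
      (f := fun u : ℝ => (u : ℂ) + z.im * Complex.I) ?_ ?_
    · exact ((Complex.ofRealCLM.contDiff).add contDiff_const).contDiffOn
    · intro u _
      simpa [him] using hz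
  have hp : Function.Periodic f 1 := by
    intro u
    have := hper (u + z.im * Complex.I) (by rw [him]; exact hz)
    simp only [hfdef]
    rw [← this]
    push_cast
    ring_nf
  have key := hasSum_fourier_of_contDiff hf hp z.re
  have hfz : f z.re = ext F z := by simp only [hfdef, Complex.re_add_im]
  rw [hfz] at key
  convert key using 2 with n
  -- `coeff` weights by `e(-n(u + iv))` rather than `e(-nu)`, so it is the Fourier coefficient on
  -- the horizontal line times `e(-niv)`.
  have h1 : coeff F n z.im =
      (∫ w in (0 : ℝ)..1, f w * e (-n * w)) * e (-n * (z.im * Complex.I)) := by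
    rw [coeff, ← intervalIntegral.integral_mul_const]
    congr 1
    ext w
    simp only [hfdef]
    rw [mul_assoc, ← e_add]
    ring_nf
  rw [h1, mul_assoc, ← e_add]
  congr 2
  linear_combination (n : ℂ) * -(Complex.re_add_im z)

/-! ### Inverses modulo `M` and reindexing of residue classes -/

lemma mul_invMod {d M : ℕ} (hM : M ≠ 0) (h : d.Coprime M) :
    (d : ℤ) * (invMod d M : ℤ) ≡ 1 [ZMOD M] := by
  -- On the empty set `sInf` would return the default `0`, so an inverse has to be exhibited.
  have hne : {j : ℕ | d * j ≡ 1 [MOD M]}.Nonempty := by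
    have : NeZero M := ⟨hM⟩
    refine ⟨((d : ZMod M)⁻¹).val, ?_⟩
    rw [Set.mem_ofPred_eq, ← ZMod.natCast_eq_natCast_iff]
    push_cast
    rw [ZMod.natCast_zmod_val, ZMod.coe_mul_inv_eq_one d h]
  have := Nat.sInf_mem hne
  exact_mod_cast (Int.natCast_modEq_iff.mpr this)

lemma sum_range_mul_eq {R : Type*} [AddCommMonoid R] (C M : ℕ) (G : ℤ → R) :
    ∑ j ∈ Finset.range (C * M), G j =
      ∑ i ∈ Finset.range M, ∑ r ∈ Finset.range C, G (i + M * r) := by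
  rw [Finset.sum_comm]
  induction C with
  | zero => simp
  | succ C ih =>
    rw [Nat.succ_mul, Finset.sum_range_add, ih, Finset.sum_range_succ]
    congr 1
    refine Finset.sum_congr rfl fun i _ => ?_
    push_cast
    ring_nf

/-- A sum over a complete residue system is invariant under an invertible affine substitution. -/
lemma sum_range_affine {R : Type*} [AddCommMonoid R] {M : ℕ} (hM : M ≠ 0) {K : ℤ → R}
    (hK : ∀ a b : ℤ, a ≡ b [ZMOD M] → K a = K b) {c x : ℤ} (hcx : c * x ≡ 1 [ZMOD M]) :
    ∑ i ∈ Finset.range M, K i = ∑ i ∈ Finset.range M, K (-x + x * i) := by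
  have hM' : (M : ℤ) ≠ 0 := by exact_mod_cast hM
  have hval : ∀ z : ℤ, (((z % M).toNat : ℕ) : ℤ) = z % M := fun z =>
    Int.toNat_of_nonneg (Int.emod_nonneg _ hM')
  have hmem : ∀ z : ℤ, (z % M).toNat ∈ Finset.range M := fun z => by
    rw [Finset.mem_range]
    have h1 := Int.emod_lt_of_pos z (b := (M : ℤ)) (by positivity)
    have h2 := hval z
    omega
  have hself : ∀ i ∈ Finset.range M, ∀ z : ℤ, z ≡ i [ZMOD M] → (z % M).toNat = i := by
    intro i hi z hz
    rw [Finset.mem_range] at hi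
    have h2 := hval z
    have h3 : z % M = i := by
      rw [hz]
      exact Int.emod_eq_of_lt (by positivity) (by exact_mod_cast hi)
    rw [h3] at h2 ⊢
    simp
  have hmodval : ∀ z : ℤ, (((z % M).toNat : ℕ) : ℤ) ≡ z [ZMOD M] := fun z => by
    rw [hval]; exact Int.mod_modEq _ _
  refine Finset.sum_nbij' (fun i => ((1 + c * i) % M).toNat) (fun i => ((-x + x * i) % M).toNat)
    (fun i _ => hmem _) (fun i _ => hmem _) ?_ ?_ ?_
  · intro i hi
    refine hself i hi _ ?_
    calc (-x + x * (((1 + c * i) % M).toNat : ℕ) : ℤ) ≡ -x + x * (1 + c * i) [ZMOD M] :=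
          (Int.ModEq.refl _).add ((Int.ModEq.refl _).mul (hmodval _))
      _ = (c * x) * i := by ring
      _ ≡ 1 * i [ZMOD M] := hcx.mul_right _
      _ = i := one_mul _
  · intro i hi
    refine hself i hi _ ?_
    calc (1 + c * (((-x + x * i) % M).toNat : ℕ) : ℤ) ≡ 1 + c * (-x + x * i) [ZMOD M] :=
          (Int.ModEq.refl _).add ((Int.ModEq.refl _).mul (hmodval _))
      _ = 1 + (c * x) * (i - 1) := by ring
      _ ≡ 1 + 1 * (i - 1) [ZMOD M] := (Int.ModEq.refl _).add (hcx.mul_right _)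
      _ = i := by ring
  · intro i _
    refine hK _ _ (Int.ModEq.symm ?_)
    calc (-x + x * (((1 + c * i) % M).toNat : ℕ) : ℤ) ≡ -x + x * (1 + c * i) [ZMOD M] :=
          (Int.ModEq.refl _).add ((Int.ModEq.refl _).mul (hmodval _))
      _ = (c * x) * i := by ring
      _ ≡ 1 * i [ZMOD M] := hcx.mul_right _
      _ = i := one_mul _

/-- Sorting the residues modulo `M` by their greatest common divisor with `M`. -/
lemma sum_range_eq_sum_divisors {R : Type*} [AddCommMonoid R] {M : ℕ} (hM : M ≠ 0) (K : ℕ → R) :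
    ∑ i ∈ Finset.range M, K i = ∑ d ∈ M.divisors,
      ∑ s ∈ (Finset.range (M / d)).filter (fun s => Nat.gcd s (M / d) = 1), K (d * s) := by
  rw [Finset.sum_sigma']
  -- The residue `i = 0` corresponds to `d = M`, `s = 0`, which passes the filter because `gcd(0, 1)
  -- = 1`.
  refine Finset.sum_bij' (fun i _ => (⟨Nat.gcd i M, i / Nat.gcd i M⟩ : Σ _ : ℕ, ℕ))
    (fun p _ => p.1 * p.2) ?_ ?_ ?_ ?_ ?_
  · intro i hi
    have hg : 0 < Nat.gcd i M := Nat.gcd_pos_of_pos_right _ (Nat.pos_of_ne_zero hM)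
    simp only [Finset.mem_sigma, Nat.mem_divisors, Finset.mem_filter, Finset.mem_range] at hi ⊢
    exact ⟨⟨Nat.gcd_dvd_right _ _, hM⟩,
      Nat.div_lt_div_of_lt_of_dvd (Nat.gcd_dvd_right _ _) hi,
      Nat.coprime_div_gcd_div_gcd hg⟩
  · rintro ⟨d, s⟩ h
    simp only [Finset.mem_sigma, Nat.mem_divisors, Finset.mem_filter, Finset.mem_range] at h ⊢
    obtain ⟨⟨⟨q, rfl⟩, -⟩, hs, -⟩ := h
    have hd : 0 < d := Nat.pos_of_ne_zero (left_ne_zero_of_mul hM)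
    rw [Nat.mul_div_cancel_left _ hd] at hs
    exact Nat.mul_lt_mul_of_pos_left hs hd
  · intro i _
    exact Nat.mul_div_cancel' (Nat.gcd_dvd_left _ _)
  · rintro ⟨d, s⟩ h
    simp only [Finset.mem_sigma, Nat.mem_divisors, Finset.mem_filter, Finset.mem_range] at h
    obtain ⟨⟨⟨q, rfl⟩, -⟩, -, hs⟩ := h
    have hd : 0 < d := Nat.pos_of_ne_zero (left_ne_zero_of_mul hM)
    rw [Nat.mul_div_cancel_left _ hd] at hs
    have hg : Nat.gcd (d * s) (d * q) = d := by rw [Nat.gcd_mul_left, hs, mul_one]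
    simp only [hg, Nat.mul_div_cancel_left _ hd]
  · intro i _
    rw [Nat.mul_div_cancel' (Nat.gcd_dvd_left _ _)]

/-- A sum over the residues modulo `C * M`, sorted by the greatest common divisor of `1 + c * j`
with `M`. -/
lemma sum_range_reindex {R : Type*} [AddCommMonoid R] {C M : ℕ} (hM : M ≠ 0) {G : ℤ → R}
    (hG : ∀ a b : ℤ, a ≡ b [ZMOD (C * M : ℕ)] → G a = G b) {c x : ℤ}
    (hcx : c * x ≡ 1 [ZMOD M]) :
    ∑ j ∈ Finset.range (C * M), G j = ∑ d ∈ M.divisors,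
      ∑ s ∈ (Finset.range (M / d)).filter (fun s => Nat.gcd s (M / d) = 1),
        ∑ r ∈ Finset.range C, G (-x + x * (d * s) + M * r) := by
  rw [sum_range_mul_eq, sum_range_affine (K := fun i => ∑ r ∈ Finset.range C, G (i + M * r)) hM ?_
    hcx, sum_range_eq_sum_divisors hM]
  · push_cast; rfl
  · intro a b hab
    -- Shifting by `M` moves `r` to `r + 1`; the term at `r = C` wraps around to `r = 0` by the
    -- period `CM` of `G`.
    have hper : ∀ a : ℤ, ∑ r ∈ Finset.range C, G (a + M + M * r) =
        ∑ r ∈ Finset.range C, G (a + M * r) := by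
      intro a
      rcases Nat.eq_zero_or_pos C with rfl | hC
      · simp
      obtain ⟨C', rfl⟩ := Nat.exists_eq_succ_of_ne_zero hC.ne'
      rw [Finset.sum_range_succ, Finset.sum_range_succ']
      refine congrArg₂ _ (Finset.sum_congr rfl fun r _ => ?_) ?_
      · congr 1; push_cast; ring
      · refine hG _ _ ?_
        refine Int.modEq_iff_dvd.mpr ⟨-1, ?_⟩
        push_cast
        ring
    have hperz : ∀ n : ℕ, ∀ a : ℤ, ∑ r ∈ Finset.range C, G (a + M * n + M * r) =
        ∑ r ∈ Finset.range C, G (a + M * r) := by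
      intro n
      induction n with
      | zero => simp
      | succ n ih =>
        intro a
        rw [← ih a, ← hper (a + M * n)]
        push_cast
        ring_nf
    obtain ⟨n, hn⟩ := hab.dvd
    rcases Int.eq_nat_or_neg n with ⟨n', rfl | rfl⟩
    · rw [← hperz n' a, show b = a + M * n' by linarith]
    · rw [← hperz n' b, show a = b + M * n' by linarith]

/-! ### The theta multiplier -/

lemma neg_one_pow_mul_of_mod_four {n a : ℕ} (h : n % 4 = 1) :
    (-1 : ℤ) ^ (a * ((n - 1) / 2)) = 1 := by
  rw [mul_comm, pow_mul, Even.neg_one_pow (by rw [Nat.even_iff]; omega), one_pow]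

lemma neg_one_pow_mul_of_mod_four' {n a : ℕ} (h : n % 4 = 3) :
    (-1 : ℤ) ^ (a * ((n - 1) / 2)) = (-1) ^ a := by
  rw [mul_comm, pow_mul, Odd.neg_one_pow (by rw [Nat.odd_iff]; omega)]

/-- Quadratic reciprocity with a denominator of arbitrary sign. -/
lemma jacobiSym_natAbs {n d : ℕ} {δ : ℤ} (hn : Odd n) (hd : Odd d) (hδ : δ ≡ d [ZMOD 4]) :
    jacobiSym n δ.natAbs = (-1) ^ ((d - 1) / 2 * ((n - 1) / 2)) * jacobiSym δ n := by
  have hd2 : d % 2 = 1 := Nat.odd_iff.mp hd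
  have hn2 : n % 2 = 1 := Nat.odd_iff.mp hn
  have hδ4 : δ % 4 = (d : ℤ) % 4 := hδ
  have hodd : Odd δ.natAbs := by rw [Nat.odd_iff]; omega
  rw [jacobiSym.quadratic_reciprocity hn hodd, mul_comm (n / 2)]
  have hn' : n / 2 = (n - 1) / 2 := by omega
  have hδ' : δ.natAbs / 2 = (δ.natAbs - 1) / 2 := by omega
  rw [hn', hδ']
  have h4 : n % 4 = 1 ∨ n % 4 = 3 := by omega
  rcases le_or_gt 0 δ with hs | hs
  · have habs : (δ.natAbs : ℤ) = δ := by omega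
    rw [habs]
    congr 1
    rcases h4 with h | h
    · rw [neg_one_pow_mul_of_mod_four h, neg_one_pow_mul_of_mod_four h]
    · rw [neg_one_pow_mul_of_mod_four' h, neg_one_pow_mul_of_mod_four' h]
      apply neg_one_pow_congr
      rw [Nat.even_iff, Nat.even_iff]
      omega
  -- Here `|δ| ≡ -d` mod 4, and the resulting change of the reciprocity sign is exactly `(-1/n) =
  -- χ₄(n)`.
  · have habs : (δ.natAbs : ℤ) = -δ := by omega
    rw [habs, jacobiSym.neg _ hn]
    rcases h4 with h | h
    · rw [neg_one_pow_mul_of_mod_four h, neg_one_pow_mul_of_mod_four h,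
        ZMod.χ₄_nat_one_mod_four h, one_mul]
    · rw [neg_one_pow_mul_of_mod_four' h, neg_one_pow_mul_of_mod_four' h,
        ZMod.χ₄_nat_three_mod_four h, ← mul_assoc, mul_neg_one, ← neg_one_mul, ← pow_succ']
      congr 1
      apply neg_one_pow_congr
      rw [Nat.even_iff, Nat.even_iff]
      omega

lemma eps_congr {a b : ℤ} (h : a ≡ b [ZMOD 4]) : eps a = eps b := by
  rw [eps, eps, h]

lemma jacobiSym_eq_of_mul_modEq_one {a b : ℤ} {q : ℕ} (h : a * b ≡ 1 [ZMOD q]) :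
    jacobiSym a q = jacobiSym b q := by
  have h1 : jacobiSym a q * jacobiSym b q = 1 := by
    rw [← jacobiSym.mul_left, jacobiSym.mod_left' h, jacobiSym.one_left]
  rcases jacobiSym.trichotomy a q with h2 | h2 | h2 <;> rw [h2] at h1 ⊢ <;> omega

/-- The theta multiplier at a matrix with lower row `(4NC²q, δ)`. -/
lemma extJacobi_eq {N C q d : ℕ} {δ s : ℤ} (hN : Odd N) (hC : C ≠ 0) (hq : Odd q) (hd : Odd d)
    (hcop : IsCoprime δ (4 * N * C ^ 2 * q)) (h4 : δ ≡ d [ZMOD 4]) (hδN : δ ≡ d [ZMOD N])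
    (hδq : δ * s ≡ 1 [ZMOD q]) :
    extJacobi (4 * N * C ^ 2 * q) δ = (-1) ^ ((d - 1) / 2 * ((N * q - 1) / 2)) *
      jacobiSym d N * jacobiSym s q := by
  have hN0 : N ≠ 0 := by rintro rfl; simp at hN
  have hq0 : q ≠ 0 := by rintro rfl; simp at hq
  have hpos : ¬ ((4 * N * C ^ 2 * q : ℤ) < 0 ∧ δ < 0) := by
    have : (0 : ℤ) ≤ 4 * N * C ^ 2 * q := by positivity
    omega
  rw [extJacobi, if_neg hpos,
    -- The square `(2C)²` drops out, leaving `(Nq/|δ|)`. Reciprocity turns it into `(δ/N)(δ/q)` up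
    -- to sign, with `δ ≡ d` mod `N` and `δ ≡ s⁻¹` mod `q`.
    show (4 * N * C ^ 2 * q : ℤ) = (2 * C) ^ 2 * ((N * q : ℕ) : ℤ) by push_cast; ring,
    jacobiSym.mul_left, jacobiSym.sq_one', one_mul, jacobiSym_natAbs (hN.mul hq) hd h4,
    jacobiSym.mul_right' _ hN0 hq0, jacobiSym.mod_left' hδN,
    jacobiSym_eq_of_mul_modEq_one hδq, mul_assoc]
  have h2 : IsCoprime (2 * C : ℤ) δ :=
    (hcop.of_isCoprime_of_dvd_right ⟨2 * N * C * q, by ring⟩).symm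
  rw [Int.isCoprime_iff_gcd_eq_one] at h2
  simpa [Int.gcd, Int.natAbs_abs] using h2

/-! ### The action of a modular transformation -/

/-- A positive real factor does not change the argument, so the principal power is multiplicative
here. -/
lemma natCast_mul_cpow {d : ℕ} (hd : 0 < d) {X : ℂ} (hX : X ≠ 0) (κ : ℝ) :
    ((d : ℂ) * X) ^ (-(κ : ℂ)) = (((d : ℝ) ^ κ : ℝ) : ℂ)⁻¹ * X ^ (-(κ : ℂ)) := by
  have hd' : (0 : ℝ) < d := by exact_mod_cast hd
  have hdc : (d : ℂ) ≠ 0 := by exact_mod_cast hd.ne'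
  rw [Complex.ofReal_cpow hd'.le, ← Complex.cpow_neg, Complex.ofReal_natCast,
    Complex.cpow_def_of_ne_zero (mul_ne_zero hdc hX), Complex.cpow_def_of_ne_zero hdc,
    Complex.cpow_def_of_ne_zero hX, ← Complex.exp_add, ← add_mul, ← Complex.ofReal_natCast,
    Complex.log_ofReal_mul hd' hX, Complex.ofReal_log hd'.le]

lemma linear_ne_zero {c D : ℤ} (h : c ≠ 0 ∨ D ≠ 0) {z : ℂ} (hz : 0 < z.im) :
    (c : ℂ) * z + D ≠ 0 := by
  intro h0
  have him := congrArg Complex.im h0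
  have hre := congrArg Complex.re h0
  simp at him hre
  rcases him with h1 | h1
  · subst h1
    simp at hre h
    exact h hre
  · exact hz.ne' h1

/-- The transformation law of a modular function in coordinates. -/
lemma ext_moebius {κ : ℝ} {F : ℍ → ℂ} (γ : SL(2, ℤ)) {ν z : ℂ} (hz : 0 < z.im)
    (h : ∀ τ, slash κ F γ τ = ν * F τ) :
    ((γ 1 0 : ℂ) * z + γ 1 1) ^ (-(κ : ℂ)) *
      ext F (((γ 0 0 : ℂ) * z + γ 0 1) / ((γ 1 0 : ℂ) * z + γ 1 1)) = ν * ext F z := by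
  have h1 := h ⟨z, hz⟩
  rw [slash] at h1
  rw [ext_of_im_pos F hz, ← h1, ← ext_coe F (γ • _), UpperHalfPlane.coe_specialLinearGroup_apply]
  simp

lemma intCast_zpow_of_odd {z : ℤ} (hz : z = 0 ∨ z = 1 ∨ z = -1) {k : ℤ} (hk : Odd k) :
    (z : ℂ) ^ k = z := by
  have hk0 : k ≠ 0 := by rintro rfl; simp at hk
  rcases hz with rfl | rfl | rfl
  · simp [zero_zpow _ hk0]
  · simp
  · simp [hk.neg_one_zpow]

/-- For odd `k` the symbol, being `0` or `±1`, equals its own `k`-th power, so `k` survives only in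
the exponent of `eps`. -/
lemma thetaMultiplier_zpow {N C q d : ℕ} {δ s k : ℤ} (hN : Odd N) (hC : C ≠ 0) (hq : Odd q)
    (hd : Odd d) (hk : Odd k) (hcop : IsCoprime δ (4 * N * C ^ 2 * q)) (h4 : δ ≡ d [ZMOD 4])
    (hδN : δ ≡ d [ZMOD N]) (hδq : δ * s ≡ 1 [ZMOD q]) {γ : SL(2, ℤ)}
    (h10 : γ 1 0 = 4 * N * C ^ 2 * q) (h11 : γ 1 1 = δ) :
    thetaMultiplier γ ^ k = (-1) ^ ((d - 1) / 2 * ((N * q - 1) / 2)) *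
      (jacobiSym d N : ℂ) * (jacobiSym s q : ℂ) * eps d ^ (-k) := by
  rw [thetaMultiplier, h10, h11, mul_zpow, intCast_zpow_of_odd ?_ hk, inv_zpow', eps_congr h4,
    extJacobi_eq hN hC hq hd hcop h4 hδN hδq]
  · push_cast; rfl
  · rw [extJacobi]
    have := jacobiSym.trichotomy (4 * N * C ^ 2 * q) δ.natAbs
    split_ifs <;> omega

/-- The integer matrix `(1, j; 0, m) (1, B; 4NC, D)` factors as an element of `Γ₀(4N)` times an upper
triangular matrix `(d, β; 0, Cq)`. -/
lemma exists_matrix_factorization {N C q d : ℕ} {B D x x₁ y s s' r j β δ : ℤ}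
    (hD : D = 1 + 4 * N * C * B) (hx : x = C * x₁)
    (hxy : 4 * (N : ℤ) * C * x + d * q * y = 1) (hs : s * s' ≡ 1 [ZMOD q])
    (hj : j = -x + x * (d * s) + d * q * r)
    (hβ : β = d * (d * q) * (y * B + r) - x * s' + D * x * d)
    (hδ : δ = D * d - 4 * N * C * β) :
    ∃ a b : ℤ, d * a = 1 + 4 * N * C * j ∧ B + D * j - a * β = C * q * b ∧
      a * δ - b * (4 * N * C ^ 2 * q) = 1 ∧ δ * s ≡ 1 [ZMOD q] := by
  obtain ⟨u, hu⟩ := hs.symm.dvd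
  -- This is `(1 + 4NCj)/d` after substituting `j` and `4NCx = 1 - dqy`; in particular `a ≡ s` mod
  -- `q`.
  obtain ⟨a, ha⟩ : ∃ a : ℤ, a = s + q * (y - y * (d * s) + 4 * N * C * r) := ⟨_, rfl⟩
  have hda : d * a = 1 + 4 * N * C * j := by
    rw [ha, hj]; linear_combination (1 - d * s) * hxy
  -- `β` is a Chinese remainder solution of `aβ ≡ B + Dj`. Mod `C`: `x ≡ 0`, `D ≡ 1`, `ad ≡ 1` and
  -- `dqy ≡ 1`, so both sides are `B + dqr`. Mod `q`: `a ≡ s`, `ss' ≡ 1` and `4NCx ≡ 1`, so both are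
  -- `-x + Dxds`.
  have hdvdC : (C : ℤ) ∣ B + D * j - a * β := by
    refine ⟨-(2 * D * x₁ + 4 * N * j * (d * q * (y * B + r) + D * x) - a * x₁ * s' -
      4 * N * x * B - 4 * N * B * (d * q) * r - D * x₁ * (d * s)), ?_⟩
    rw [hβ]
    linear_combination (-(d * q * (y * B + r) + D * x)) * hda - B * hxy + D * hj +
      (-2 * D + a * s' + D * (d * s)) * hx + d * q * r * hD
  have hdvdq : (q : ℤ) ∣ B + D * j - a * β := by
    refine ⟨-((y - y * (d * s) + 4 * N * C * r) * β + s * d * d * (y * B + r) - x * u -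
      D * d * r - d * y * B), ?_⟩
    rw [hj, ha]
    linear_combination (-s) * hβ + x * hu - B * hxy - x * hD
  have hcop : IsCoprime (C : ℤ) q := ⟨4 * N * x, d * y, by linear_combination hxy⟩
  obtain ⟨b, hb⟩ := hcop.mul_dvd hdvdC hdvdq
  have hdet : a * δ - b * (4 * N * C ^ 2 * q) = 1 := by
    rw [hδ]; linear_combination D * hda + 4 * N * C * hb + hD
  refine ⟨a, b, hda, hb, hdet, Int.modEq_iff_dvd.mpr
    ⟨δ * (y - y * (d * s) + 4 * N * C * r) - b * (4 * N * C ^ 2), ?_⟩⟩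
  linear_combination (-1 : ℤ) * hdet + δ * ha

/-- The value of a modular function at a translate `(γτ + j)/m`, expressed by its value at
`(d²τ + dβ)/m`. -/
lemma transform_translate {N C q d m : ℕ} {k B D x x₁ y s s' r j β : ℤ} {F : ℍ → ℂ}
    (hN : Odd N) (hk : Odd k) (hC : C ≠ 0) (hq : Odd q) (hd : Odd d)
    (hF : ∀ γ ∈ CongruenceSubgroup.Gamma0 (4 * N), ∀ τ : ℍ,
      slash ((k : ℝ) / 2) F γ τ = thetaMultiplier γ ^ k * F τ)
    (hm : m = C * (d * q)) (hD : D = 1 + 4 * N * C * B) (hx : x = C * x₁)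
    (hxy : 4 * (N : ℤ) * C * x + d * q * y = 1) (hs : s * s' ≡ 1 [ZMOD q])
    (hj : j = -x + x * (d * s) + d * q * r)
    (hβ : β = d * (d * q) * (y * B + r) - x * s' + D * x * d) {z : ℂ} (hz : 0 < z.im) :
    (((4 * N * C : ℤ) : ℂ) * z + D) ^ (-(((k : ℝ) / 2 : ℝ) : ℂ)) *
        ext F (((z + B) / (((4 * N * C : ℤ) : ℂ) * z + D) + j) / m) =
      (-1) ^ ((d - 1) / 2 * ((N * q - 1) / 2)) * (jacobiSym d N : ℂ) * (jacobiSym s q : ℂ) *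
        eps d ^ (-k) * (((d : ℝ) ^ ((k : ℝ) / 2) : ℝ) : ℂ) *
        ext F ((d ^ 2 * z + d * β) / m) := by
  have hd0 : 0 < d := hd.pos
  have hq0 : 0 < q := hq.pos
  obtain ⟨δ, hδ⟩ : ∃ δ : ℤ, δ = D * d - 4 * N * C * β := ⟨_, rfl⟩
  obtain ⟨a, b, hda, hb, hdet, hδs⟩ := exists_matrix_factorization hD hx hxy hs hj hβ hδ
  have hδ4 : δ ≡ d [ZMOD 4] :=
    Int.modEq_iff_dvd.mpr ⟨-(N * C * B * d) + N * C * β, by rw [hδ, hD]; ring⟩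
  have hδN : δ ≡ d [ZMOD N] :=
    Int.modEq_iff_dvd.mpr ⟨-(4 * C * B * d) + 4 * C * β, by rw [hδ, hD]; ring⟩
  obtain ⟨g, h00, h01, h10, h11⟩ : ∃ g : SL(2, ℤ), g 0 0 = a ∧ g 0 1 = b ∧
      g 1 0 = 4 * N * C ^ 2 * q ∧ g 1 1 = δ :=
    ⟨⟨!![a, b; 4 * N * C ^ 2 * q, δ], by rw [Matrix.det_fin_two_of, hdet]⟩, rfl, rfl, rfl, rfl⟩
  have hg : g ∈ CongruenceSubgroup.Gamma0 (4 * N) := by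
    rw [CongruenceSubgroup.Gamma0_mem, h10, ZMod.intCast_zmod_eq_zero_iff_dvd]
    exact ⟨C ^ 2 * q, by push_cast; ring⟩
  have hmul := thetaMultiplier_zpow hN hC hq hd hk ⟨a, -b, by linear_combination hdet⟩
    hδ4 hδN hδs h10 h11
  have hCc : (C : ℂ) ≠ 0 := by exact_mod_cast hC
  have hqc : (q : ℂ) ≠ 0 := by exact_mod_cast hq0.ne'
  have hdc : (d : ℂ) ≠ 0 := by exact_mod_cast hd0.ne'
  have hmc : (m : ℂ) = C * (d * q) := by rw [hm]; push_cast; ring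
  have hm0 : (m : ℂ) ≠ 0 := by rw [hmc]; positivity
  have hw' : ((d ^ 2 * z + d * β) / m : ℂ) = (d * z + β) / (C * q) := by
    rw [hmc]; field_simp
  rw [hw']
  obtain ⟨w, hw⟩ : ∃ w : ℂ, w = (d * z + β) / (C * q) := ⟨_, rfl⟩
  have hwmul : w * (C * q) = d * z + β := by rw [hw]; field_simp
  rw [← hw]
  have hwim : 0 < w.im := by
    have : w = (((d : ℝ) / (C * q) : ℝ) : ℂ) * z + ((β / (C * q) : ℝ) : ℂ) := by
      rw [hw]; push_cast; ring
    rw [this]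
    simp only [Complex.add_im, Complex.im_ofReal_mul, Complex.ofReal_im, add_zero]
    have : (0 : ℝ) < C := by exact_mod_cast Nat.pos_of_ne_zero hC
    positivity
  have key := ext_moebius g hwim (hF g hg)
  rw [h00, h01, h10, h11, hmul] at key
  have hX : ((4 * N * C : ℤ) : ℂ) * z + D ≠ 0 := by
    refine linear_ne_zero ?_ hz
    by_contra! h
    have h1 := hD
    rw [h.1, h.2] at h1
    simp at h1
  obtain ⟨X, hXdef⟩ : ∃ X : ℂ, X = ((4 * N * C : ℤ) : ℂ) * z + D := ⟨_, rfl⟩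
  rw [← hXdef] at hX ⊢
  have hXdef' : X = 4 * N * C * z + D := by rw [hXdef]; push_cast; ring
  have hδc : (δ : ℂ) = D * d - 4 * N * C * β := by rw [hδ]; push_cast; ring
  -- The automorphy factor of `g` at `w` is `d` times that of `γ` at `z`; this is the source of
  -- `d^(k/2)`.
  have hden : ((4 * N * C ^ 2 * q : ℤ) : ℂ) * w + (δ : ℂ) = d * X := by
    push_cast
    linear_combination (4 * N * C : ℂ) * hwmul + hδc - d * hXdef'
  have hbc : (B : ℂ) + D * j - a * β = C * q * b := by exact_mod_cast hb
  have hdac : (d : ℂ) * a = 1 + 4 * N * C * j := by exact_mod_cast hda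
  have harg : ((a : ℂ) * w + b) / (d * X) = ((z + B) / X + j) / m := by
    have h1 : ((a : ℂ) * w + b) * (C * q) = z + B + j * X := by
      linear_combination (a : ℂ) * hwmul + z * hdac - hbc - j * hXdef'
    rw [div_add' _ _ _ hX, div_div, ← h1, hmc, div_eq_div_iff (mul_ne_zero hdc hX)
      (mul_ne_zero hX (hmc ▸ hm0))]
    ring
  rw [hden, harg, natCast_mul_cpow hd0 hX] at key
  have hdpow : (((d : ℝ) ^ ((k : ℝ) / 2) : ℝ) : ℂ) ≠ 0 := by
    have : (0 : ℝ) < (d : ℝ) ^ ((k : ℝ) / 2) := Real.rpow_pos_of_pos (by exact_mod_cast hd0) _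
    exact_mod_cast this.ne'
  rw [mul_assoc, inv_mul_eq_iff_eq_mul₀ hdpow] at key
  rw [key]
  ring

/-! ### The operator `U` and the inner sums -/

lemma ext_add_one {k : ℤ} {M : ℕ} {F : ℍ → ℂ} (hF : IsHarmonicMaassForm k M F) {z : ℂ}
    (hz : 0 < z.im) : ext F (z + 1) = ext F z := by
  have hT : ModularGroup.T ∈ CongruenceSubgroup.Gamma0 M := by
    rw [CongruenceSubgroup.Gamma0_mem]; simp [ModularGroup.T]
  have hν : thetaMultiplier ModularGroup.T = 1 := by
    simp [thetaMultiplier, extJacobi, eps, ModularGroup.T]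
  have := ext_moebius ModularGroup.T hz (hF.modular _ hT)
  rw [hν, one_zpow, one_mul] at this
  simpa [ModularGroup.T] using this

lemma ext_add_intCast {F : ℍ → ℂ} (hper : ∀ z : ℂ, 0 < z.im → ext F (z + 1) = ext F z) {z : ℂ}
    (hz : 0 < z.im) (n : ℤ) : ext F (z + n) = ext F z := by
  have hnat : ∀ (n : ℕ) (z : ℂ), 0 < z.im → ext F (z + n) = ext F z := by
    intro n
    induction n with
    | zero => simp
    | succ n ih =>
      intro z hz
      rw [← ih z hz, ← hper (z + n) (by simpa using hz)]
      push_cast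
      ring_nf
  rcases Int.eq_nat_or_neg n with ⟨n', rfl | rfl⟩
  · exact hnat n' z hz
  · rw [← hnat n' (z + (-(n' : ℤ) : ℤ)) (by simpa using hz)]
    push_cast
    ring_nf

/-- The operator `U` as an average over translates. -/
lemma hasSum_UTerm {F : ℍ → ℂ} (hF : ContDiffOn ℝ ∞ (ext F) {z : ℂ | 0 < z.im})
    (hper : ∀ z : ℂ, 0 < z.im → ext F (z + 1) = ext F z) {m : ℕ} (hm : 0 < m) (t : ℤ) (τ : ℍ) :
    HasSum (UTerm m t F τ)
      (1 / m * ∑ j ∈ Finset.range m, e (-(j * t) / m) * ext F ((τ + j) / m)) := by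
  have hm' : (m : ℂ) ≠ 0 := by exact_mod_cast hm.ne'
  have him : ∀ j : ℕ, (((τ : ℂ) + j) / m).im = τ.im / m := fun j => by
    rw [Complex.div_natCast_im]; simp
  have h1 : ∀ j : ℕ, HasSum (fun n : ℤ => e (-(j * t) / m) *
      (coeff F n (τ.im / m) * e (n * ((τ + j) / m)))) (e (-(j * t) / m) * ext F ((τ + j) / m)) := by
    intro j
    have hpos : 0 < (((τ : ℂ) + j) / m).im := by
      rw [him]; exact div_pos τ.im_pos (by exact_mod_cast hm)
    have := (hasSum_coeff hF hper hpos).mul_left (e (-(j * t) / m))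
    rwa [him] at this
  refine ((hasSum_sum fun j (_ : j ∈ Finset.range m) => h1 j).mul_left (1 / (m : ℂ))).congr_fun ?_
  intro n
  have h2 : ∀ j : ℕ, e (-(j * t) / m) * (coeff F n (τ.im / m) * e (n * ((τ + j) / m))) =
      coeff F n (τ.im / m) * e (n * τ / m) * e ((j : ℂ) * ((n - t : ℤ) / m)) := by
    intro j
    rw [mul_left_comm, ← e_add, mul_assoc, ← e_add]
    congr 2
    push_cast
    field_simp
    ring
  simp_rw [h2]
  rw [← Finset.mul_sum, sum_range_e_div hm.ne', UTerm]
  have hiff : n ≡ t [ZMOD m] ↔ (m : ℤ) ∣ n - t := by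
    rw [Int.modEq_comm, Int.modEq_iff_dvd]
  simp only [hiff]
  split_ifs
  · field_simp
  · simp

/-- An exact identity of exponents that separates the variables: `r` occurs only in the last factor
and `s` only in the one before it. -/
lemma summand_phase {C d q m : ℕ} (hC : C ≠ 0) (hd : d ≠ 0) (hq : q ≠ 0) (hm : m = C * (d * q))
    {t B D x x₁ y s s' r j β n : ℤ} (hx : x = C * x₁) (hj : j = -x + x * (d * s) + d * q * r)
    (hβ : β = d * (d * q) * (y * B + r) - x * s' + D * x * d) (z : ℂ) :
    e (-(j * t) / m) * e (n * ((d ^ 2 * z + d * β) / m)) =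
      e (d ^ 2 * n / m * z) * e (x * t / m) * e (n * d ^ 2 * y * B / C) *
        e (d ^ 2 * n * x * D / m) * e (-(x₁ * (s' * n + s * t)) / q) *
        e (r * ((n * d ^ 2 - t : ℤ) / C)) := by
  have hC' : (C : ℂ) ≠ 0 := by exact_mod_cast hC
  have hd' : (d : ℂ) ≠ 0 := by exact_mod_cast hd
  have hq' : (q : ℂ) ≠ 0 := by exact_mod_cast hq
  simp only [← e_add]
  congr 1
  rw [hm, hj, hβ, hx]
  push_cast
  field_simp
  ring

/-- The contribution of the residue classes `j` with `gcd(1 + 4NCj, m/C) = d`. -/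
lemma sum_translates_eq {F : ℍ → ℂ} (hF : ContDiffOn ℝ ∞ (ext F) {z : ℂ | 0 < z.im})
    (hper : ∀ z : ℂ, 0 < z.im → ext F (z + 1) = ext F z) {N m t C d q : ℕ} {B D x x₁ y : ℤ}
    (hC : C ≠ 0) (hd : d ≠ 0) (hq : q ≠ 0) (hm : m = C * (d * q)) (hx : x = C * x₁)
    (hdC : d.Coprime C) (hcop : Int.gcd (N * C) q = 1) (j β : ℕ → ℕ → ℤ)
    (hj : ∀ s r, j s r = -x + x * (d * s) + d * q * r)
    (hβ : ∀ s r, β s r = d * (d * q) * (y * B + r) - x * invMod s q + D * x * d) (τ : ℍ) :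
    Summable (innerTerm F N m t C D x τ d) ∧
    ∑ s ∈ (Finset.range q).filter (fun s => Nat.gcd s q = 1), ∑ r ∈ Finset.range C,
      e (-(j s r * t) / m) * ((jacobiSym s q : ℂ) * ext F ((d ^ 2 * τ + d * β s r) / m)) =
    C * e (x * t / m) * e (t * y * B / C + d ^ 2 * (invMod d C : ℂ) ^ 2 * x * D * t / m) *
      (jacobiSym ((N : ℤ) * C) q : ℂ) * ∑' n : ℤ, innerTerm F N m t C D x τ d n := by
  have hC' : (C : ℂ) ≠ 0 := by exact_mod_cast hC
  have hd' : (d : ℂ) ≠ 0 := by exact_mod_cast hd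
  have hq' : (q : ℂ) ≠ 0 := by exact_mod_cast hq
  have hm0 : m ≠ 0 := by rw [hm]; positivity
  have hmr : (0 : ℝ) < m := by exact_mod_cast Nat.pos_of_ne_zero hm0
  have him : ∀ s r, ((d ^ 2 * (τ : ℂ) + d * β s r) / m).im = (d : ℝ) ^ 2 / m * τ.im := by
    intro s r
    rw [show (d ^ 2 * (τ : ℂ) + d * β s r) / m =
      (((d : ℝ) ^ 2 / m : ℝ) : ℂ) * τ + ((d * β s r / m : ℝ) : ℂ) by push_cast; ring]
    simp only [Complex.add_im, Complex.im_ofReal_mul, Complex.ofReal_im, add_zero,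
      UpperHalfPlane.coe_im]
  have hv : 0 < (d : ℝ) ^ 2 / m * τ.im := by
    have := τ.im_pos
    positivity
  set W : ℤ → ℂ := fun n => ∑ s ∈ (Finset.range q).filter (fun s => Nat.gcd s q = 1),
    ∑ r ∈ Finset.range C, e (-(j s r * t) / m) * ((jacobiSym s q : ℂ) *
      (coeff F n ((d : ℝ) ^ 2 / m * τ.im) * e (n * ((d ^ 2 * τ + d * β s r) / m)))) with hW
  have hsum : HasSum W (∑ s ∈ (Finset.range q).filter (fun s => Nat.gcd s q = 1),
      ∑ r ∈ Finset.range C, e (-(j s r * t) / m) *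
        ((jacobiSym s q : ℂ) * ext F ((d ^ 2 * τ + d * β s r) / m))) := by
    refine hasSum_sum fun s _ => hasSum_sum fun r _ => ?_
    refine HasSum.mul_left _ (HasSum.mul_left _ ?_)
    have := hasSum_coeff hF hper (z := (d ^ 2 * (τ : ℂ) + d * β s r) / m) (by rw [him]; exact hv)
    rwa [him] at this
  -- The double sum factors, and orthogonality evaluates the sum over `r` as `C` or `0`.
  have hWeq : ∀ n, W n = coeff F n ((d : ℝ) ^ 2 / m * τ.im) * e (d ^ 2 * n / m * τ) *
      e (x * t / m) * e (n * d ^ 2 * y * B / C) * e (d ^ 2 * n * x * D / m) *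
      (∑ s ∈ (Finset.range q).filter (fun s => Nat.gcd s q = 1), (jacobiSym s q : ℂ) *
        e (-(x₁ * (invMod s q * n + s * t)) / q)) *
      (if (C : ℤ) ∣ n * d ^ 2 - t then (C : ℂ) else 0) := by
    intro n
    rw [← sum_range_e_div hC, mul_assoc, Finset.sum_mul_sum, Finset.mul_sum]
    refine Finset.sum_congr rfl fun s _ => ?_
    rw [Finset.mul_sum]
    refine Finset.sum_congr rfl fun r _ => ?_
    have := summand_phase (t := t) (n := n) hC hd hq hm hx (hj s r) (hβ s r) (τ : ℂ)
    simp only [Int.cast_natCast] at this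
    linear_combination (jacobiSym s q * coeff F n ((d : ℝ) ^ 2 / m * τ.im) : ℂ) * this
  have hinv := mul_invMod hC hdC
  have hinv2 : (invMod d C : ℤ) ^ 2 * d ^ 2 ≡ 1 [ZMOD C] := by
    have := hinv.pow 2
    rwa [mul_pow, one_pow, mul_comm] at this
  -- `ι` parametrises the solutions `n` of `d²n ≡ t` mod `C`, namely the class of `d̄²t`.
  set ι : ℤ → ℤ := fun n => (C : ℤ) * n + (invMod d C : ℤ) ^ 2 * t with hι
  have hinj : Function.Injective ι := by
    intro a b hab
    simpa [hι, hC] using hab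
  have hdvd : ∀ n, (C : ℤ) ∣ ι n * d ^ 2 - t := by
    intro n
    obtain ⟨u, hu⟩ := hinv2.symm.dvd
    exact ⟨n * d ^ 2 + t * u, by rw [hι]; linear_combination (t : ℤ) * hu⟩
  have hsupp : ∀ n, n ∉ Set.range ι → W n = 0 := by
    intro n hn
    rw [hWeq, if_neg, mul_zero]
    rintro ⟨u, hu⟩
    obtain ⟨w, hw⟩ := hinv2.symm.dvd
    refine hn ⟨(invMod d C : ℤ) ^ 2 * u - n * w, ?_⟩
    rw [hι]
    linear_combination -(invMod d C : ℤ) ^ 2 * hu + n * hw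
  have hqdiv : m / (C * d) = q := by
    rw [hm, ← mul_assoc]
    exact Nat.mul_div_cancel_left _ (Nat.pos_of_ne_zero (mul_ne_zero hC hd))
  have hMdiv : m / C = d * q := by
    rw [hm]
    exact Nat.mul_div_cancel_left _ (Nat.pos_of_ne_zero hC)
  have hxdiv : x / (C : ℤ) = x₁ := by
    rw [hx]
    exact Int.mul_ediv_cancel_left _ (by exact_mod_cast hC)
  -- The symbol `(NC/q)` occurs both in `T` and in the prefactor; the two cancel because `NC` is
  -- coprime to `q`.
  have hJ : (jacobiSym ((N : ℤ) * C) q : ℂ) * jacobiSym ((N : ℤ) * C) q = 1 := by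
    rw [← pow_two]
    exact_mod_cast jacobiSym.sq_one hcop
  set P : ℂ := C * e (x * t / m) *
    e (t * y * B / C + d ^ 2 * (invMod d C : ℂ) ^ 2 * x * D * t / m) *
    (jacobiSym ((N : ℤ) * C) q : ℂ) with hP
  have hcomp : ∀ n, W (ι n) = P * innerTerm F N m t C D x τ d n := by
    intro n
    rw [hWeq, if_pos (hdvd n), innerTerm, T, hqdiv, hMdiv, hxdiv, hP]
    have e1 : e (ι n * d ^ 2 * y * B / C) = e (t * y * B / C) := by
      obtain ⟨u, hu⟩ := hdvd n
      have hu' : (ι n : ℂ) * d ^ 2 - t = C * u := by exact_mod_cast hu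
      refine e_eq_of_sub_eq_intCast (u * y * B) ?_
      push_cast
      field_simp
      linear_combination (y * B : ℂ) * hu'
    have hιc : (ι n : ℂ) = C * n + (invMod d C : ℂ) ^ 2 * t := by rw [hι]; push_cast; ring
    have e2 : e (d ^ 2 * ι n * x * D / m) =
        e (d ^ 2 * D * n * x / (d * q : ℕ)) * e (d ^ 2 * (invMod d C : ℂ) ^ 2 * x * D * t / m) := by
      rw [← e_add, hιc, hm]
      congr 1
      push_cast
      field_simp
    have e3 : ∑ s ∈ (Finset.range q).filter (fun s => Nat.gcd s q = 1), (jacobiSym s q : ℂ) *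
        e (-(x₁ * (invMod s q * ι n + s * t)) / q) =
        ∑ s ∈ (Finset.range q).filter (fun s => Nat.gcd s q = 1), (jacobiSym s q : ℂ) *
        e ((-(x₁ * ((invMod s q : ℤ) * ((invMod d C : ℤ) ^ 2 * t + C * n) +
          (s : ℤ) * t)) : ℤ) / (q : ℂ)) := by
      refine Finset.sum_congr rfl fun s _ => ?_
      rw [hιc]
      push_cast
      ring_nf
    rw [e1, e2, e3, e_add, hιc]
    set S := ∑ s ∈ (Finset.range q).filter (fun s => Nat.gcd s q = 1), (jacobiSym s q : ℂ) *
        e ((-(x₁ * ((invMod s q : ℤ) * ((invMod d C : ℤ) ^ 2 * t + C * n) +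
          (s : ℤ) * t)) : ℤ) / (q : ℂ))
    linear_combination (-(C * e (x * t / m) * e (t * y * B / C) *
      e (d ^ 2 * (invMod d C : ℂ) ^ 2 * x * D * t / m) * coeff F (ι n) ((d : ℝ) ^ 2 / m * τ.im) *
      e (d ^ 2 * D * n * x / (d * q : ℕ)) * S *
      e ((d : ℂ) ^ 2 * (C * n + (invMod d C : ℂ) ^ 2 * t) / m * τ)) : ℂ) * hJ
  -- A nonzero prefactor lets summability of `W ∘ ι` pass to `innerTerm`.
  have hP0 : P ≠ 0 := by
    have he : ∀ z, e z ≠ 0 := fun z => Complex.exp_ne_zero _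
    exact mul_ne_zero (mul_ne_zero (mul_ne_zero hC' (he _)) (he _)) (left_ne_zero_of_mul_eq_one hJ)
  have hfin := (hinj.hasSum_iff hsupp).mpr hsum
  rw [show W ∘ ι = fun n => P * innerTerm F N m t C D x τ d n from funext hcomp] at hfin
  exact ⟨(summable_mul_left_iff hP0).mp hfin.summable, by rw [← tsum_mul_left, hfin.tsum_eq]⟩

end ThetaMaass

/-! ### Assembly of the transformation formula -/

theorem mainTheorem9 (N m t C : ℕ) (k B D x y : ℤ) (F : ℍ → ℂ) (γ : SL(2, ℤ))
    (hN : Odd N) (hk : Odd k) (hk1 : 1 ≤ k)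
    (hF : ThetaMaass.IsHarmonicMaassForm k (4 * N) F)
    (hm : 1 ≤ m) (ht : t < m)
    (hγ : (γ : Matrix (Fin 2) (Fin 2) ℤ) = !![1, B; 4 * (N : ℤ) * C, D])
    (hC : C ∣ m) (hcop : Nat.gcd (m / C) (4 * N * C) = 1)
    (hxy : 4 * (N : ℤ) * C * x + ((m / C : ℕ) : ℤ) * y = 1) (hx : (C : ℤ) ∣ x) :
    (∀ τ : ℍ, HasSum (fun n : ℤ => ThetaMaass.coeff F n τ.im * ThetaMaass.e (n * (τ : ℂ))) (F τ)) ∧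
    (∀ τ : ℍ, Summable (ThetaMaass.UTerm m t F τ)) ∧
    (∀ τ : ℍ, ∀ d ∈ (m / C).divisors, Summable (ThetaMaass.innerTerm F N m t C D x τ d)) ∧
    ∀ τ : ℍ,
      ThetaMaass.slash ((k : ℝ) / 2) (ThetaMaass.U m t F) γ τ =
        (C : ℂ) / m *
          ∑ d ∈ (m / C).divisors,
            ThetaMaass.e ((x : ℂ) * t / m) *
            ThetaMaass.e ((t : ℂ) * y * B / C +
              (d : ℂ) ^ 2 * (ThetaMaass.invMod d C : ℂ) ^ 2 * x * D * t / m) *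
            ThetaMaass.eps (d : ℤ) ^ (-k) * ThetaMaass.delta N m C d *
            (((d : ℝ) ^ ((k : ℝ) / 2) : ℝ) : ℂ) *
            ∑' n : ℤ, ThetaMaass.innerTerm F N m t C D x τ d n := by
  obtain ⟨M, hM⟩ : ∃ M, M = m / C := ⟨_, rfl⟩
  have hC0 : C ≠ 0 := by rintro rfl; rw [zero_dvd_iff] at hC; omega
  have hmM : m = C * M := by rw [hM, Nat.mul_div_cancel' hC]
  have hM0 : M ≠ 0 := by rintro rfl; omega
  rw [← hM] at hcop hxy ⊢
  have hMc : Nat.Coprime M (4 * N * C) := hcop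
  have hModd : Odd M := by
    rw [← Nat.coprime_two_right]
    exact hMc.coprime_dvd_right ⟨2 * N * C, by ring⟩
  have hMC : Nat.Coprime M C := hMc.coprime_dvd_right ⟨4 * N, by ring⟩
  have hMNC : Nat.Coprime M (N * C) := hMc.coprime_dvd_right ⟨4, by ring⟩
  obtain ⟨x₁, hx₁⟩ := hx
  have h00 : γ 0 0 = 1 := by rw [hγ]; rfl
  have h01 : γ 0 1 = B := by rw [hγ]; rfl
  have h10 : γ 1 0 = 4 * (N : ℤ) * C := by rw [hγ]; rfl
  have h11 : γ 1 1 = D := by rw [hγ]; rfl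
  have hD : D = 1 + 4 * N * C * B := by
    have := Matrix.det_fin_two (γ : Matrix (Fin 2) (Fin 2) ℤ)
    rw [γ.det_coe, h00, h01, h10, h11] at this
    linarith
  have hper : ∀ z : ℂ, 0 < z.im → ThetaMaass.ext F (z + 1) = ThetaMaass.ext F z :=
    fun z hz => ThetaMaass.ext_add_one hF hz
  have hdiv : ∀ d ∈ M.divisors, ∃ q, M = d * q ∧ d ≠ 0 ∧ q ≠ 0 ∧ Odd d ∧ Odd q := by
    intro d hd
    obtain ⟨q, hq⟩ := Nat.dvd_of_mem_divisors hd
    rw [hq] at hModd hM0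
    exact ⟨q, hq, left_ne_zero_of_mul hM0, right_ne_zero_of_mul hM0,
      Nat.Odd.of_mul_left hModd, Nat.Odd.of_mul_right hModd⟩
  have hinner := fun (τ : ℍ) (d q : ℕ) (hdq : M = d * q) (hd0 : d ≠ 0) (hq0 : q ≠ 0) =>
    ThetaMaass.sum_translates_eq (t := t) (N := N) (B := B) (D := D) (y := y) hF.smooth hper
      hC0 hd0 hq0 (hmM.trans (by rw [hdq])) hx₁ (hMC.coprime_dvd_left ⟨q, hdq⟩)
      (by
        have := (hMNC.coprime_dvd_left ⟨d, hdq.trans (mul_comm _ _)⟩).symm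
        exact_mod_cast this)
      (fun s r => -x + x * (d * s) + d * q * r)
      (fun s r => d * (d * q) * (y * B + r) - x * ThetaMaass.invMod s q + D * x * d)
      (fun _ _ => rfl) (fun _ _ => rfl) τ
  refine ⟨fun τ => ?_, fun τ => (ThetaMaass.hasSum_UTerm hF.smooth hper hm t τ).summable,
    fun τ d hd => ?_, fun τ => ?_⟩
  · have := ThetaMaass.hasSum_coeff hF.smooth hper τ.im_pos
    rwa [ThetaMaass.ext_coe] at this
  · obtain ⟨q, hdq, hd0, hq0, -, -⟩ := hdiv d hd
    exact (hinner τ d q hdq hd0 hq0).1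
  have hcoe : ((γ • τ : ℍ) : ℂ) = (τ + B) / (((4 * N * C : ℤ) : ℂ) * τ + D) := by
    rw [UpperHalfPlane.coe_specialLinearGroup_apply, h00, h01, h10, h11]
    simp
  rw [ThetaMaass.slash, ThetaMaass.U, (ThetaMaass.hasSum_UTerm hF.smooth hper hm t (γ • τ)).tsum_eq,
    h10, h11]
  obtain ⟨X, hX⟩ : ∃ X : ℂ, X = (((4 * N * C : ℤ) : ℂ) * τ + D) ^ (-(((k : ℝ) / 2 : ℝ) : ℂ)) :=
    ⟨_, rfl⟩
  have hm0 : m ≠ 0 := by omega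
  set G : ℤ → ℂ := fun j => ThetaMaass.e (-(j * t) / m) *
    (X * ThetaMaass.ext F (((γ • τ : ℍ) + j) / m)) with hG
  -- Both the character and `F((γτ + j)/m)` depend only on `j` mod `m`, which allows the change of
  -- representatives.
  have hGper : ∀ a b : ℤ, a ≡ b [ZMOD (C * M : ℕ)] → G a = G b := by
    intro a b hab
    rw [← hmM] at hab
    have h1 := ThetaMaass.e_div_eq_of_modEq hm0 ((hab.mul_right t).neg)
    obtain ⟨u, hu⟩ := hab.symm.dvd
    have hu' : (a : ℂ) - b = m * u := by exact_mod_cast hu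
    have h2 : (((γ • τ : ℍ) : ℂ) + a) / m = ((γ • τ : ℍ) + b) / m + u := by
      have : (m : ℂ) ≠ 0 := by exact_mod_cast hm0
      field_simp
      linear_combination hu'
    have h3 : 0 < ((((γ • τ : ℍ) : ℂ) + b) / m).im := by
      rw [Complex.div_natCast_im]
      simp only [Complex.add_im, Complex.intCast_im, add_zero, UpperHalfPlane.coe_im]
      have := (γ • τ).im_pos
      positivity
    push_cast at h1
    simp only [hG]
    rw [h1, h2, ThetaMaass.ext_add_intCast hper h3]
  have hsum : X * (1 / m * ∑ j ∈ Finset.range m, ThetaMaass.e (-(j * (t : ℤ)) / m) *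
      ThetaMaass.ext F (((γ • τ : ℍ) + j) / m)) = 1 / m * ∑ j ∈ Finset.range (C * M), G j := by
    rw [← hmM, mul_left_comm, Finset.mul_sum]
    congr 1
    refine Finset.sum_congr rfl fun j _ => ?_
    simp only [hG, Int.cast_natCast]
    ring
  have hcx : 4 * (N : ℤ) * C * x ≡ 1 [ZMOD M] :=
    Int.modEq_iff_dvd.mpr ⟨y, by linear_combination -hxy⟩
  rw [← hX, hsum, ThetaMaass.sum_range_reindex hM0 hGper hcx, Finset.mul_sum, Finset.mul_sum]
  refine Finset.sum_congr rfl fun d hd => ?_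
  obtain ⟨q, hdq, hd0, hq0, hdodd, hqodd⟩ := hdiv d hd
  have hqdiv : M / d = q := by rw [hdq, Nat.mul_div_cancel_left _ (Nat.pos_of_ne_zero hd0)]
  have hqdiv' : m / (C * d) = q := by rw [← Nat.div_div_eq_div_mul, ← hM, hqdiv]
  have hmdq : m = C * (d * q) := by rw [hmM, hdq]
  have hMc' : (M : ℤ) = d * q := by exact_mod_cast hdq
  have hterm : ∀ s ∈ (Finset.range q).filter (fun s => Nat.gcd s q = 1), ∀ r ∈ Finset.range C,
      G (-x + x * (d * s) + M * r) =
        ((-1) ^ ((d - 1) / 2 * ((N * q - 1) / 2)) * (jacobiSym d N : ℂ) *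
          ThetaMaass.eps d ^ (-k) * (((d : ℝ) ^ ((k : ℝ) / 2) : ℝ) : ℂ)) *
        (ThetaMaass.e (-((-x + x * (d * s) + d * q * r : ℤ) * (t : ℤ)) / m) *
          ((jacobiSym s q : ℂ) * ThetaMaass.ext F ((d ^ 2 * τ + d *
            (d * (d * q) * (y * B + r) - x * ThetaMaass.invMod s q + D * x * d : ℤ)) / m))) := by
    intro s hs r _
    have htr := ThetaMaass.transform_translate (r := r) hN hk hC0 hqodd hdodd hF.modular hmdq hD hx₁
      (hMc' ▸ hxy) (ThetaMaass.mul_invMod hq0 (Finset.mem_filter.mp hs).2) rfl rfl τ.im_pos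
    rw [← hX, ← hcoe] at htr
    simp only [hG, hMc', Int.cast_natCast]
    rw [htr]
    ring
  rw [hqdiv, Finset.sum_congr rfl fun s hs => Finset.sum_congr rfl (hterm s hs)]
  simp_rw [← Finset.mul_sum]
  have hin := (hinner τ d q hdq hd0 hq0).2
  simp only [Int.cast_natCast] at hin ⊢
  -- The reciprocity sign and `(d/N)` from the multiplier join `(NC/q)` from the inner sum to form
  -- `δ_d`; the sum over `r` supplied the `C` in `C/m`.
  rw [hin, ThetaMaass.delta, hqdiv']
  ring
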